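/- A signed graph $(G,\sigma)$ is a finite simple graph $G$ together with a function $\sigma:E(G)\to\{+,-\}$; a closed walk of $(G,\sigma)$ is positive if it uses an even number of negative edges (counted with multiplicity), and negative otherwise. A homomorphism of $(G,\sigma)$ to $(H,\pi)$ is a map $f:V(G)\to V(H)$ that preserves adjacencies and the signs of closed walks. The signed chromatic number $\chi_s((G,\sigma))$ is the minimum order $|V(H)|$ of a signed graph $(H,\pi)$ to which $(G,\sigma)$ admits a homomorphism, and for a family $\mathcal F$ of graphs $$\chi_s(\mathcal F)=\max\{\chi_s((G,\sigma)) : G\in\mathcal F,\ \sigma:E(G)\to\{+,-\}\}.$$ **Theorem.** Let $\mathcal G^{\rm c}_3$ be the family of all connected graphs of maximum degree at most $3$. Then $\chi_s(\mathcal G^{\rm c}_3)=6$. -/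

import Mathlib

universe u v

/-- A signed graph `(G, σ)` on the vertex set `V`: a simple graph `G` together with a
signature `σ : E(G) → {+, -}`. The two signs are the elements `1` and `-1` of `ℤˣ`. -/
structure SignedGraph (V : Type u) where
  /-- The underlying simple graph. -/
  graph : SimpleGraph V
  /-- The signature. -/
  sign : graph.edgeSet → ℤˣ

namespace SignedGraph

variable {V : Type u} {W : Type v}

/-- The sign of a walk: the product of the signs of its edges, counted with multiplicity. It is
`1` exactly when the walk has an even number of negative edges. -/
def walkSign (S : SignedGraph V) : {a b : V} → S.graph.Walk a b → ℤˣ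
  | _, _, .nil => 1
  | a, _, .cons (v := c) h p => S.sign ⟨s(a, c), h⟩ * walkSign S p

/-- `f` is a homomorphism of the signed graph `S` to the signed graph `T`: it preserves
adjacencies (it is a homomorphism of the underlying graphs), and it preserves the signs of closed
walks. -/
def IsHom (S : SignedGraph V) (T : SignedGraph W) (f : S.graph →g T.graph) : Prop :=
  ∀ (a : V) (p : S.graph.Walk a a), T.walkSign (p.map f) = S.walkSign p

/-- `(G, σ) → (H, π)`: there is a homomorphism. -/
def Maps (S : SignedGraph V) (T : SignedGraph W) : Prop :=
  ∃ f : S.graph →g T.graph, S.IsHom T f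

/-- The signed chromatic number of a signed graph: the minimum order `|V(H)|` of a (finite) signed
graph `(H, π)` to which it admits a homomorphism. For finite signed graphs this minimum exists,
see `isLeast_chromaticNumber`. -/
noncomputable def chromaticNumber (S : SignedGraph V) : ℕ :=
  sInf {n : ℕ | ∃ (W : Type u) (_ : Finite W) (T : SignedGraph W), Nat.card W = n ∧ S.Maps T}

theorem maps_refl (S : SignedGraph V) : S.Maps S :=
  ⟨SimpleGraph.Hom.id, fun _ p => congrArg S.walkSign (SimpleGraph.Walk.map_id p)⟩

/-- The minimum in the definition of the signed chromatic number of a finite signed graph is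
attained. -/
theorem isLeast_chromaticNumber [Finite V] (S : SignedGraph V) :
    IsLeast {n : ℕ | ∃ (W : Type u) (_ : Finite W) (T : SignedGraph W),
      Nat.card W = n ∧ S.Maps T} S.chromaticNumber :=
  ⟨Nat.sInf_mem ⟨Nat.card V, V, inferInstance, S, rfl, S.maps_refl⟩, fun _ hn => Nat.sInf_le hn⟩

/-- The family `F` of (finite) graphs has signed chromatic number `k`: `k` is the maximum of the
signed chromatic numbers of all signed graphs `(G, σ)` with `G ∈ F`. In particular the maximum
exists and is attained. -/
def FamilyHasChromaticNumber (F : ∀ (V : Type u), SimpleGraph V → Prop) (k : ℕ) : Prop :=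
  IsGreatest {n : ℕ | ∃ (V : Type u) (_ : Finite V) (S : SignedGraph V),
    F V S.graph ∧ n = S.chromaticNumber} k

end SignedGraph

/-- The family of connected graphs with maximum degree at most `Δ`. -/
def ConnectedMaxDegreeLE (Δ : ℕ) (V : Type u) (G : SimpleGraph V) : Prop :=
  G.Connected ∧ ∀ v : V, (G.neighborSet v).encard ≤ Δ

/-! For the upper bound the target is a signed `K₆` on the diagonals of the icosahedron. A map to it
amounts to labelling the vertices of `G` by the 12 icosahedron vertices so that positive edges join
adjacent labels and negative edges join a label to a neighbour of the antipode of the other. The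
choice of end of a diagonal records a switching.

A vertex sees each labelled neighbour as a colour, twisted by the sign of the edge. Two seen colours
have at least two common neighbours unless they are antipodal, when they have none. A greedy
labelling can avoid antipodal pairs as long as each new vertex has at most two labelled neighbours
(`TameOn.exists_insert`). By connectedness this labels every proper subset (`exists_tameOn`), and
the whole graph when some degree is at most 2.

In the cubic case a small configuration is left out and labelled last: a triangle, a 4-cycle, or,
when neither exists, the double star around an edge. The first two rest on finite checks in the
icosahedron (`exists_triangle`, `exists_square`), the third on counting (`exists_of_four_le_card`).
`K₄` escapes the triangle argument but has only four vertices.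

For the lower bound, in a suitable signature of `K₃,₃` any two vertices on the same side are
opposite on a negative 4-cycle, so every homomorphism is injective. -/

/-! ### Adjacency, antipodes and local colourings in the icosahedron. -/

/-- The adjacency matrix of the icosahedron graph on `Fin 12`, row by row in binary. The antipode
of the vertex `x` is `x ^^^ 1`. -/
def icosahedronCode : ℕ := 3713615167969122945781435808328929014810020

/-- Adjacency in the icosahedron graph. -/
def IcoAdj (x y : Fin 12) : Prop := icosahedronCode.testBit (12 * x.val + y.val) = true

instance : DecidableRel IcoAdj := fun x y =>
  inferInstanceAs (Decidable (icosahedronCode.testBit (12 * x.val + y.val) = true))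

/-- The antipode of a vertex of the icosahedron. -/
def antipode (x : Fin 12) : Fin 12 :=
  ⟨x.val ^^^ 1, by revert x; decide⟩

/-- The vertex `x` or its antipode, according to the sign `s`. -/
def signed (s : ℤˣ) (x : Fin 12) : Fin 12 := if s = 1 then x else antipode x

theorem antipode_antipode (x : Fin 12) : antipode (antipode x) = x := by
  revert x; decide

@[simp] theorem signed_one (x : Fin 12) : signed 1 x = x := rfl

@[simp] theorem signed_neg_one (x : Fin 12) : signed (-1) x = antipode x := rfl

theorem signed_signed (s t : ℤˣ) (x : Fin 12) : signed s (signed t x) = signed (s * t) x := by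
  rcases Int.units_eq_one_or s with rfl | rfl <;> rcases Int.units_eq_one_or t with rfl | rfl <;>
    simp [antipode_antipode]

@[simp] theorem signed_signed_self (s : ℤˣ) (x : Fin 12) : signed s (signed s x) = x := by
  simp [signed_signed]

theorem signed_antipode (s : ℤˣ) (x : Fin 12) :
    signed s (antipode x) = antipode (signed s x) := by
  rcases Int.units_eq_one_or s with rfl | rfl <;> simp

theorem signed_injective (s : ℤˣ) : Function.Injective (signed s) :=
  Function.LeftInverse.injective (signed_signed_self s)

theorem antipode_ne (x : Fin 12) : antipode x ≠ x := by
  revert x; decide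

namespace IcoAdj

theorem symm {x y : Fin 12} (h : IcoAdj x y) : IcoAdj y x := by
  revert x y; decide +kernel

theorem antipode_antipode_iff {x y : Fin 12} :
    IcoAdj (antipode x) (antipode y) ↔ IcoAdj x y := by
  revert x y; decide +kernel

theorem signed_iff (s : ℤˣ) {x y : Fin 12} : IcoAdj (signed s x) (signed s y) ↔ IcoAdj x y := by
  rcases Int.units_eq_one_or s with rfl | rfl
  · rfl
  · exact antipode_antipode_iff

/-- The antipodal map is an automorphism, so the sign of an edge may be charged to either endpoint.
-/
theorem signed_left_iff (s : ℤˣ) {x y : Fin 12} :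
    IcoAdj (signed s x) y ↔ IcoAdj x (signed s y) := by
  rw [← signed_iff s, signed_signed_self]

theorem card_neighbors (p : Fin 12) : (Finset.univ.filter fun z => IcoAdj z p).card = 5 := by
  revert p; decide +kernel

theorem two_le_card_common {p q : Fin 12} (h : p ≠ antipode q) :
    2 ≤ (Finset.univ.filter fun z => IcoAdj z p ∧ IcoAdj z q).card := by
  revert p q; decide +kernel

theorem exists_common_avoiding {p q : Fin 12} (h : p ≠ antipode q) (t : Fin 12) :
    ∃ z, IcoAdj z p ∧ IcoAdj z q ∧ z ≠ t ∧ z ≠ antipode t := by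
  revert p q t; decide +kernel

/-- If `p ≠ q`, the two common neighbours have five neighbours each and share exactly two, which
gives 5 + 5 - 2 = 8. If `p = q` there are even more. -/
theorem eight_le_card_second {p q : Fin 12} (h : p ≠ antipode q) :
    8 ≤ (Finset.univ.filter fun z => ∃ x, IcoAdj x p ∧ IcoAdj x q ∧ IcoAdj z x).card := by
  revert p q; decide +kernel

/-- Neighbourhoods have size 5 and two distinct ones share at most two vertices, so the union has at
least 5 + 3 + 1 elements. -/
theorem nine_le_card_union {x y z : Fin 12} (hxy : x ≠ y) (hxz : x ≠ z) (hyz : y ≠ z) :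
    9 ≤ (Finset.univ.filter fun w => IcoAdj x w ∨ IcoAdj y w ∨ IcoAdj z w).card := by
  revert x y z; decide +kernel

/-- There is an edge between any two sets of at least four vertices. -/
theorem exists_of_four_le_card {S T : Finset (Fin 12)} (hS : 4 ≤ S.card) (hT : 4 ≤ T.card) :
    ∃ x ∈ S, ∃ y ∈ T, IcoAdj x y := by
  obtain ⟨x, y, z, hx, hy, hz, hxy, hxz, hyz⟩ := Finset.two_lt_card_iff.mp (by omega : 2 < S.card)
  -- Three vertices of `S` miss at most three of the twelve as neighbours, so one of the four in `T`
  -- is hit.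
  have h := nine_le_card_union hxy hxz hyz
  obtain ⟨w, hw⟩ := Finset.inter_nonempty_of_card_lt_card_add_card
    (Finset.subset_univ (Finset.univ.filter fun w => IcoAdj x w ∨ IcoAdj y w ∨ IcoAdj z w))
    (Finset.subset_univ T) (by rw [Finset.card_univ, Fintype.card_fin]; omega)
  simp only [Finset.mem_inter, Finset.mem_filter, Finset.mem_univ, true_and] at hw
  rcases hw with ⟨h | h | h, hwT⟩
  exacts [⟨x, hx, w, hwT, h⟩, ⟨y, hy, w, hwT, h⟩, ⟨z, hz, w, hwT, h⟩]

/-- Some condition on the `pᵢ` is needed: the neighbours of a single vertex span a pentagon, which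
contains no triangle. -/
theorem exists_triangle_aux (s : ℤˣ) {p₁ p₂ p₃ : Fin 12} (h : p₁ ≠ p₂) (h' : p₁ ≠ antipode p₂) :
    ∃ x₁, IcoAdj x₁ p₁ ∧ ∃ x₂, IcoAdj x₂ p₂ ∧ IcoAdj x₁ x₂ ∧ ∃ x₃, IcoAdj x₃ p₃ ∧
      IcoAdj x₂ x₃ ∧ IcoAdj x₃ (signed s x₁) := by
  rcases Int.units_eq_one_or s with rfl | rfl
  · simp only [signed_one]
    revert p₁ p₂ p₃; decide +kernel
  · simp only [signed_neg_one]
    revert p₁ p₂ p₃; decide +kernel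

/-- A signed triangle can be coloured when its vertices have one further neighbour each, unless
the colours seen there are equal up to sign. -/
theorem exists_triangle (s₁₂ s₂₃ s₃₁ : ℤˣ) {p₁ p₂ : Fin 12} (p₃ : Fin 12) (h : p₁ ≠ p₂)
    (h' : p₁ ≠ antipode p₂) :
    ∃ x₁ x₂ x₃, IcoAdj x₁ p₁ ∧ IcoAdj x₂ p₂ ∧ IcoAdj x₃ p₃ ∧ IcoAdj x₁ (signed s₁₂ x₂) ∧
      IcoAdj x₂ (signed s₂₃ x₃) ∧ IcoAdj x₃ (signed s₃₁ x₁) := by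
  have hp : p₁ ≠ signed s₁₂ p₂ ∧ p₁ ≠ antipode (signed s₁₂ p₂) := by
    rcases Int.units_eq_one_or s₁₂ with rfl | rfl
    · exact ⟨h, h'⟩
    · exact ⟨h', by simpa [antipode_antipode] using h⟩
  -- Switching at the second and third vertices moves all signs onto the closing edge, which then
  -- carries their product.
  obtain ⟨x₁, h₁, x₂, h₂, h₁₂, x₃, h₃, h₂₃, h₃₁⟩ :=
    exists_triangle_aux (s₁₂ * s₂₃ * s₃₁) (p₃ := signed (s₁₂ * s₂₃) p₃) hp.1 hp.2
  refine ⟨x₁, signed s₁₂ x₂, signed (s₁₂ * s₂₃) x₃, h₁, ?_, ?_, ?_, ?_, ?_⟩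
  · rwa [signed_left_iff]
  · rwa [signed_left_iff]
  · simpa [signed_signed] using h₁₂
  · rw [signed_left_iff, signed_signed, signed_signed, Int.units_mul_self]
    exact h₂₃
  · simpa [signed_left_iff, signed_signed, ← mul_assoc] using h₃₁

/-- A 4-cycle of signs `+, +, +, s` can be coloured such that its vertices are adjacent to `p₁`,
`p₂`, `p₃`, `p₄`. -/
def SquareColorable (s : ℤˣ) (p₁ p₂ p₃ p₄ : Fin 12) : Prop :=
  ∃ x₁, IcoAdj x₁ p₁ ∧ ∃ x₂, IcoAdj x₂ p₂ ∧ IcoAdj x₁ x₂ ∧ ∃ x₃, IcoAdj x₃ p₃ ∧ IcoAdj x₂ x₃ ∧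
    ∃ x₄, IcoAdj x₄ p₄ ∧ IcoAdj x₃ x₄ ∧ IcoAdj x₄ (signed s x₁)

instance (s : ℤˣ) (p₁ p₂ p₃ p₄ : Fin 12) : Decidable (SquareColorable s p₁ p₂ p₃ p₄) :=
  inferInstanceAs (Decidable (∃ _, _))

/-- Automorphisms commuting with the antipodal map preserve the property, so the finite check is
needed for only a few values of `p₁`. -/
theorem SquareColorable.map {s : ℤˣ} {p₁ p₂ p₃ p₄ : Fin 12} (h : SquareColorable s p₁ p₂ p₃ p₄)
    (e : Fin 12 → Fin 12) (he : ∀ x y, IcoAdj x y → IcoAdj (e x) (e y))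
    (he' : ∀ x, e (antipode x) = antipode (e x)) :
    SquareColorable s (e p₁) (e p₂) (e p₃) (e p₄) := by
  obtain ⟨x₁, h₁, x₂, h₂, h₁₂, x₃, h₃, h₂₃, x₄, h₄, h₃₄, h₄₁⟩ := h
  refine ⟨e x₁, he _ _ h₁, e x₂, he _ _ h₂, he _ _ h₁₂, e x₃, he _ _ h₃, he _ _ h₂₃, e x₄,
    he _ _ h₄, he _ _ h₃₄, ?_⟩
  have := he _ _ h₄₁
  rcases Int.units_eq_one_or s with rfl | rfl
  · exact this
  · simpa only [signed_neg_one, he'] using this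

theorem SquareColorable.forall_map {s : ℤˣ} {a : Fin 12}
    (h : ∀ p₂ p₃ p₄, SquareColorable s a p₂ p₃ p₄)
    (e : Fin 12 → Fin 12) (he : ∀ x y, IcoAdj x y → IcoAdj (e x) (e y))
    (he' : ∀ x, e (antipode x) = antipode (e x)) (hs : Function.Surjective e)
    (p₂ p₃ p₄ : Fin 12) : SquareColorable s (e a) p₂ p₃ p₄ := by
  obtain ⟨q₂, rfl⟩ := hs p₂
  obtain ⟨q₃, rfl⟩ := hs p₃
  obtain ⟨q₄, rfl⟩ := hs p₄
  exact (h q₂ q₃ q₄).map e he he'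

/-- The rotation of the icosahedron about the axis through `10` and `11`. -/
def rotate (x : Fin 12) : Fin 12 := if x < 8 then x + 2 else if x < 10 then x - 8 else x

theorem squareColorable_zero_pos (p₂ p₃ p₄ : Fin 12) :
    SquareColorable 1 0 p₂ p₃ p₄ := by
  revert p₂ p₃ p₄; decide +kernel

theorem squareColorable_zero_neg (p₂ p₃ p₄ : Fin 12) :
    SquareColorable (-1) 0 p₂ p₃ p₄ := by
  revert p₂ p₃ p₄; decide +kernel

theorem squareColorable_ten_pos (p₂ p₃ p₄ : Fin 12) :
    SquareColorable 1 10 p₂ p₃ p₄ := by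
  revert p₂ p₃ p₄; decide +kernel

theorem squareColorable_ten_neg (p₂ p₃ p₄ : Fin 12) :
    SquareColorable (-1) 10 p₂ p₃ p₄ := by
  revert p₂ p₃ p₄; decide +kernel

theorem squareColorable (s : ℤˣ) (p₁ p₂ p₃ p₄ : Fin 12) : SquareColorable s p₁ p₂ p₃ p₄ := by
  have hr : ∀ a, (∀ p₂ p₃ p₄, SquareColorable s a p₂ p₃ p₄) →
      ∀ p₂ p₃ p₄, SquareColorable s (rotate a) p₂ p₃ p₄ := fun a h =>
    SquareColorable.forall_map h rotate (by decide +kernel) (by decide) (by decide)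
  have ha : ∀ a, (∀ p₂ p₃ p₄, SquareColorable s a p₂ p₃ p₄) →
      ∀ p₂ p₃ p₄, SquareColorable s (antipode a) p₂ p₃ p₄ := fun a h =>
    SquareColorable.forall_map h antipode (by decide +kernel) (by decide) (by decide)
  have h0 : ∀ p₂ p₃ p₄, SquareColorable s 0 p₂ p₃ p₄ := by
    rcases Int.units_eq_one_or s with rfl | rfl
    exacts [squareColorable_zero_pos, squareColorable_zero_neg]
  have h10 : ∀ p₂ p₃ p₄, SquareColorable s 10 p₂ p₃ p₄ := by
    rcases Int.units_eq_one_or s with rfl | rfl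
    exacts [squareColorable_ten_pos, squareColorable_ten_neg]
  -- The rotation carries 0 through 2, 4, 6, 8 and the antipodal map gives the odd vertices; only
  -- the axis needs the separate check at 10.
  have h2 := hr _ h0
  have h4 := hr _ h2
  have h6 := hr _ h4
  have h8 := hr _ h6
  have h1 := ha _ h0
  have h3 := ha _ h2
  have h5 := ha _ h4
  have h7 := ha _ h6
  have h9 := ha _ h8
  have h11 := ha _ h10
  fin_cases p₁
  exacts [h0 _ _ _, h1 _ _ _, h2 _ _ _, h3 _ _ _, h4 _ _ _, h5 _ _ _, h6 _ _ _, h7 _ _ _,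
    h8 _ _ _, h9 _ _ _, h10 _ _ _, h11 _ _ _]

/-- A signed 4-cycle can be coloured when its vertices have one further neighbour each. -/
theorem exists_square (s₁₂ s₂₃ s₃₄ s₄₁ : ℤˣ) (p₁ p₂ p₃ p₄ : Fin 12) :
    ∃ x₁ x₂ x₃ x₄, IcoAdj x₁ p₁ ∧ IcoAdj x₂ p₂ ∧ IcoAdj x₃ p₃ ∧ IcoAdj x₄ p₄ ∧
      IcoAdj x₁ (signed s₁₂ x₂) ∧ IcoAdj x₂ (signed s₂₃ x₃) ∧ IcoAdj x₃ (signed s₃₄ x₄) ∧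
      IcoAdj x₄ (signed s₄₁ x₁) := by
  obtain ⟨x₁, h₁, x₂, h₂, h₁₂, x₃, h₃, h₂₃, x₄, h₄, h₃₄, h₄₁⟩ :=
    squareColorable (s₁₂ * s₂₃ * s₃₄ * s₄₁) p₁ (signed s₁₂ p₂) (signed (s₁₂ * s₂₃) p₃)
      (signed (s₁₂ * s₂₃ * s₃₄) p₄)
  refine ⟨x₁, signed s₁₂ x₂, signed (s₁₂ * s₂₃) x₃, signed (s₁₂ * s₂₃ * s₃₄) x₄, h₁, ?_, ?_, ?_,
    ?_, ?_, ?_, ?_⟩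
  · rwa [signed_left_iff]
  · rwa [signed_left_iff]
  · rwa [signed_left_iff]
  · simpa [signed_signed] using h₁₂
  · rw [signed_left_iff, signed_signed, signed_signed, Int.units_mul_self]
    exact h₂₃
  · rw [signed_left_iff, signed_signed, signed_signed, Int.units_mul_self]
    exact h₃₄
  · simpa [signed_left_iff, signed_signed, ← mul_assoc] using h₄₁

end IcoAdj

/-! ### Greedy labelling of proper subsets. -/

section Greedy

variable {V : Type u} (G : SimpleGraph V) (σ : V → V → ℤˣ)

/-- `f` is a homomorphism on the edges inside `D` of the signed graph `(G, σ)` to the icosahedron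
graph with positive edges between adjacent and negative edges between second-nearest vertices. -/
def ColorsOn (D : Finset V) (f : V → Fin 12) : Prop :=
  ∀ u ∈ D, ∀ v ∈ D, G.Adj u v → IcoAdj (f u) (signed (σ u v) (f v))

/-- A colouring of `D` such that no uncoloured vertex with at most two coloured neighbours sees a
pair of antipodal colours. -/
structure TameOn [DecidableRel G.Adj] (D : Finset V) (f : V → Fin 12) : Prop where
  colorsOn : ColorsOn G σ D f
  not_antipodal : ∀ v ∉ D, (D.filter (G.Adj v)).card ≤ 2 → ∀ x ∈ D, ∀ y ∈ D, G.Adj v x →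
    G.Adj v y → signed (σ v x) (f x) ≠ antipode (signed (σ v y) (f y))

variable {G σ}

theorem ColorsOn.insert [DecidableEq V] (hσ : ∀ u v, σ u v = σ v u) {D : Finset V} {f : V → Fin 12}
    (h : ColorsOn G σ D f) {v : V} (hv : v ∉ D) {c : Fin 12}
    (hc : ∀ u ∈ D, G.Adj v u → IcoAdj c (signed (σ v u) (f u))) :
    ColorsOn G σ (insert v D) (Function.update f v c) := by
  intro a ha b hb hab
  rw [Finset.mem_insert] at ha hb
  have hne : ∀ u ∈ D, Function.update f v c u = f u := fun u hu =>
    Function.update_of_ne (fun h : u = v => hv (h ▸ hu)) _ _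
  rcases ha with rfl | ha <;> rcases hb with rfl | hb
  · exact absurd hab (G.loopless.irrefl _)
  · rw [Function.update_self, hne b hb]
    exact hc b hb hab
  · rw [Function.update_self, hne a ha, hσ, ← IcoAdj.signed_left_iff]
    exact (hc a ha hab.symm).symm
  · rw [hne a ha, hne b hb]
    exact h a ha b hb hab

variable [DecidableRel G.Adj]

/-- The constraints at `v` reduce to being adjacent to `p` and `q`. With at most one labelled
neighbour they coincide, which leaves five candidates instead of two. -/
theorem TameOn.exists_pair {D : Finset V} {f : V → Fin 12} (h : TameOn G σ D f) {v : V}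
    (hv : v ∉ D) (hcard : (D.filter (G.Adj v)).card ≤ 2) :
    ∃ p q, p ≠ antipode q ∧
      (∀ u ∈ D, G.Adj v u → signed (σ v u) (f u) = p ∨ signed (σ v u) (f u) = q) ∧
      ((D.filter (G.Adj v)).card ≤ 1 → p = q) := by
  rcases (D.filter (G.Adj v)).eq_empty_or_nonempty with he | ⟨x, hx⟩
  · refine ⟨0, 0, (antipode_ne 0).symm, fun u hu hvu => ?_, fun _ => rfl⟩
    exact absurd (Finset.mem_filter.mpr ⟨hu, hvu⟩) (he ▸ Finset.notMem_empty u)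
  obtain ⟨hxD, hvx⟩ := Finset.mem_filter.mp hx
  by_cases hall : ∀ u ∈ D, G.Adj v u → signed (σ v u) (f u) = signed (σ v x) (f x)
  · exact ⟨_, _, (antipode_ne _).symm, fun u hu hvu => Or.inl (hall u hu hvu), fun _ => rfl⟩
  push Not at hall
  obtain ⟨y, hyD, hvy, hne⟩ := hall
  have hxy : x ≠ y := fun h => hne (h ▸ rfl)
  have hy : y ∈ D.filter (G.Adj v) := Finset.mem_filter.mpr ⟨hyD, hvy⟩
  refine ⟨_, _, h.not_antipodal v hv hcard x hxD y hyD hvx hvy, fun u hu hvu => ?_, fun h1 => ?_⟩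
  · by_contra! hcon
    have hux : u ≠ x := fun h => hcon.1 (h ▸ rfl)
    have huy : u ≠ y := fun h => hcon.2 (h ▸ rfl)
    have := Finset.two_lt_card_iff.mpr
      ⟨u, x, y, Finset.mem_filter.mpr ⟨hu, hvu⟩, hx, hy, hux, huy, hxy⟩
    omega
  · exact absurd (Finset.card_le_one.mp h1 x hx y hy) hxy

theorem card_filter_adj_le [Fintype V] {k : ℕ}
    {v : V} (hdeg : (Finset.univ.filter (G.Adj v)).card ≤ k + 1) {D : Finset V} {u : V}
    (hu : u ∉ D) (hvu : G.Adj v u) : (D.filter (G.Adj v)).card ≤ k := by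
  have : (D.filter (G.Adj v)).card < (Finset.univ.filter (G.Adj v)).card := by
    refine Finset.card_lt_card ⟨Finset.filter_subset_filter _ (Finset.subset_univ _), fun h => ?_⟩
    exact hu (Finset.mem_filter.mp (h (Finset.mem_filter.mpr ⟨Finset.mem_univ u, hvu⟩))).1
  omega

/-- Each unlabelled neighbour of `v` rules out at most one colour for `v`. If `v` has two labelled
neighbours, at most one of two or more candidates is lost; otherwise at most three of five. -/
theorem TameOn.exists_insert [Fintype V] [DecidableEq V] (hσ : ∀ u v, σ u v = σ v u)
    (hdeg : ∀ v, (Finset.univ.filter (G.Adj v)).card ≤ 3) {D : Finset V} {f : V → Fin 12}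
    (h : TameOn G σ D f) {v : V} (hv : v ∉ D) (hcard : (D.filter (G.Adj v)).card ≤ 2) :
    ∃ c, TameOn G σ (insert v D) (Function.update f v c) := by
  obtain ⟨p, q, hpq, hseen, heq⟩ := h.exists_pair hv hcard
  set A := Finset.univ.filter fun z => IcoAdj z p ∧ IcoAdj z q with hA
  -- `F w` is the colour at `v` that would make `w` see an antipodal pair. If `w` has no labelled
  -- neighbour the value 0 is spurious, but it is already counted. If `w` has several, it ends with
  -- at least three and tameness asks nothing of it.
  let F : V → Fin 12 := fun w =>
    if hw : ∃ x ∈ D, G.Adj w x then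
      signed (σ w v) (antipode (signed (σ w hw.choose) (f hw.choose)))
    else 0
  set B := (Finset.univ.filter fun w => G.Adj v w ∧ w ∉ D).image F with hB
  have hBcard : B.card + (D.filter (G.Adj v)).card ≤ 3 := by
    refine le_trans (Nat.add_le_add_right Finset.card_image_le _) (le_trans ?_ (hdeg v))
    rw [← Finset.card_union_of_disjoint]
    · refine Finset.card_le_card fun w hw => ?_
      simp only [Finset.mem_union, Finset.mem_filter, Finset.mem_univ, true_and] at hw ⊢
      tauto
    · rw [Finset.disjoint_left]
      intro w hw hw'
      simp only [Finset.mem_filter, Finset.mem_univ, true_and] at hw hw'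
      exact hw.2 hw'.1
  have hAB : B.card < A.card := by
    by_cases h1 : (D.filter (G.Adj v)).card ≤ 1
    · obtain rfl := heq h1
      have := IcoAdj.card_neighbors p
      simp only [and_self] at hA
      rw [← hA] at this
      omega
    · have := IcoAdj.two_le_card_common hpq
      rw [← hA] at this
      omega
  obtain ⟨c, hcA, hcB⟩ := Finset.exists_mem_notMem_of_card_lt_card hAB
  simp only [hA, Finset.mem_filter, Finset.mem_univ, true_and] at hcA
  have hne : ∀ u ∈ D, Function.update f v c u = f u := fun u hu =>
    Function.update_of_ne (fun h : u = v => hv (h ▸ hu)) _ _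
  refine ⟨c, h.colorsOn.insert hσ hv fun u hu hvu => ?_, fun w hw hwcard x hx y hy hwx hwy => ?_⟩
  · rcases hseen u hu hvu with h | h <;> rw [h]
    exacts [hcA.1, hcA.2]
  rw [Finset.mem_insert, not_or] at hw
  rw [Finset.mem_insert] at hx hy
  by_cases hwv : G.Adj w v
  · have hle : (D.filter (G.Adj w)).card ≤ 1 := by
      rw [Finset.filter_insert, if_pos hwv, Finset.card_insert_of_notMem
        (fun h => hv (Finset.mem_filter.mp h).1)] at hwcard
      omega
    have huniq : ∀ x ∈ D, ∀ y ∈ D, G.Adj w x → G.Adj w y → x = y := fun x hx y hy h h' =>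
      Finset.card_le_one.mp hle x (Finset.mem_filter.mpr ⟨hx, h⟩) y (Finset.mem_filter.mpr ⟨hy, h'⟩)
    have hFw : ∀ x ∈ D, G.Adj w x → signed (σ w v) c ≠ antipode (signed (σ w x) (f x)) := by
      intro x hx hwx hc
      refine hcB (Finset.mem_image.mpr ⟨w, ?_, ?_⟩)
      · simpa using ⟨hwv.symm, hw.2⟩
      · have hex : ∃ x ∈ D, G.Adj w x := ⟨x, hx, hwx⟩
        simp only [F, dif_pos hex]
        rw [huniq _ hex.choose_spec.1 x hx hex.choose_spec.2 hwx, ← hc, signed_signed_self]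
    rcases hx with rfl | hx <;> rcases hy with rfl | hy
    · exact (antipode_ne _).symm
    · rw [Function.update_self, hne y hy]
      exact hFw y hy hwy
    · rw [Function.update_self, hne x hx]
      intro hc
      exact hFw x hx hwx (by rw [hc, antipode_antipode])
    · rw [huniq x hx y hy hwx hwy]
      exact (antipode_ne _).symm
  · have hx : x ∈ D := hx.resolve_left fun h => hwv (h ▸ hwx)
    have hy : y ∈ D := hy.resolve_left fun h => hwv (h ▸ hwy)
    rw [hne x hx, hne y hy]
    rw [Finset.filter_insert, if_neg hwv] at hwcard
    exact h.not_antipodal w hw.2 hwcard x hx y hy hwx hwy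

/-- In a connected subcubic graph, every proper subset of the vertices has a tame colouring. -/
theorem exists_tameOn [Fintype V] [DecidableEq V] (hσ : ∀ u v, σ u v = σ v u) (hG : G.Connected)
    (hdeg : ∀ v, (Finset.univ.filter (G.Adj v)).card ≤ 3) (D : Finset V)
    (hD : D ≠ Finset.univ) : ∃ f, TameOn G σ D f := by
  induction hn : D.card generalizing D with
  | zero =>
    obtain rfl := Finset.card_eq_zero.mp hn
    exact ⟨fun _ => 0, fun u hu => absurd hu (Finset.notMem_empty u),
      fun _ _ _ x hx => absurd hx (Finset.notMem_empty x)⟩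
  | succ n ih =>
    obtain ⟨a, ha⟩ : D.Nonempty := Finset.card_pos.mp (by omega)
    obtain ⟨b, hb⟩ : ∃ b, b ∉ D := by
      by_contra! h
      exact hD (Finset.eq_univ_iff_forall.mpr h)
    obtain ⟨p⟩ := hG.preconnected a b
    -- The vertex labelled last is one with a neighbour outside `D`, hence with at most two labelled
    -- neighbours.
    obtain ⟨d, -, hd, hd'⟩ := p.exists_boundary_dart (D : Set V) ha hb
    rw [Finset.mem_coe] at hd hd'
    have hv : d.fst ∉ D.erase d.fst := Finset.notMem_erase _ _
    obtain ⟨f, hf⟩ := ih (D.erase d.fst) (fun h => hv (h ▸ Finset.mem_univ _))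
      (by rw [Finset.card_erase_of_mem hd]; omega)
    obtain ⟨c, hc⟩ := hf.exists_insert hσ hdeg hv
      (card_filter_adj_le (hdeg _) (fun h => hd' (Finset.mem_of_mem_erase h)) d.adj)
    rw [Finset.insert_erase hd] at hc
    exact ⟨_, hc⟩

end Greedy

/-! ### Counting the colours available at the centre of a cherry. -/

namespace IcoAdj

theorem flip {s : ℤˣ} {x y : Fin 12} (h : IcoAdj x (signed s y)) : IcoAdj y (signed s x) :=
  (signed_left_iff s).mp h.symm

theorem eight_le_card_second_signed {p q : Fin 12} (h : p ≠ antipode q) (s : ℤˣ) :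
    8 ≤ (Finset.univ.filter fun z =>
      ∃ x, IcoAdj x p ∧ IcoAdj x q ∧ IcoAdj z (signed s x)).card := by
  rw [← Finset.card_image_of_injective _ (signed_injective s)]
  refine (eight_le_card_second h).trans (Finset.card_le_card fun z hz => ?_)
  obtain ⟨x, hp, hq, hz⟩ := (Finset.mem_filter.mp hz).2
  refine Finset.mem_image.mpr ⟨signed s z, Finset.mem_filter.mpr ⟨Finset.mem_univ _, x, hp, hq, ?_⟩,
    signed_signed_self s z⟩
  rwa [signed_iff]

/-- Each leaf allows at least 8 of the 12 colours at the centre, so two leaves together allow at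
least 8 + 8 - 12 = 4. -/
theorem four_le_card_cherry {p q p' q' : Fin 12} (h : p ≠ antipode q) (h' : p' ≠ antipode q')
    (s s' : ℤˣ) :
    4 ≤ (Finset.univ.filter fun z =>
      (∃ x, IcoAdj x p ∧ IcoAdj x q ∧ IcoAdj z (signed s x)) ∧
      ∃ x, IcoAdj x p' ∧ IcoAdj x q' ∧ IcoAdj z (signed s' x)).card := by
  rw [Finset.filter_and]
  have h₁ := eight_le_card_second_signed h s
  have h₂ := eight_le_card_second_signed h' s'
  have h₃ := Finset.card_union_add_card_inter
    (Finset.univ.filter fun z => ∃ x, IcoAdj x p ∧ IcoAdj x q ∧ IcoAdj z (signed s x))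
    (Finset.univ.filter fun z => ∃ x, IcoAdj x p' ∧ IcoAdj x q' ∧ IcoAdj z (signed s' x))
  have h₄ := Finset.card_le_univ
    ((Finset.univ.filter fun z => ∃ x, IcoAdj x p ∧ IcoAdj x q ∧ IcoAdj z (signed s x)) ∪
    (Finset.univ.filter fun z => ∃ x, IcoAdj x p' ∧ IcoAdj x q' ∧ IcoAdj z (signed s' x)))
  rw [Fintype.card_fin] at h₄
  omega

end IcoAdj

/-! ### Extending a labelling over a triangle, a 4-cycle or a double star. -/

section Extension

variable {V : Type u} [Fintype V] [DecidableEq V] {G : SimpleGraph V} {σ : V → V → ℤˣ}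

theorem ColorsOn.extend (hσ : ∀ u v, σ u v = σ v u) {D : Finset V} {f g : V → Fin 12}
    (h : ColorsOn G σ D f) (hg : ∀ v ∈ D, g v = f v)
    (hout : ∀ v ∉ D, ∀ u, G.Adj v u → IcoAdj (g v) (signed (σ v u) (g u))) :
    ColorsOn G σ Finset.univ g := by
  intro u _ v _ huv
  by_cases hu : u ∈ D
  · by_cases hv : v ∈ D
    · rw [hg u hu, hg v hv]
      exact h u hu v hv huv
    · rw [hσ]
      exact (hout v hv u huv.symm).flip
  · exact hout u hu v huv

theorem ColorsOn.exists_of_triangle (hσ : ∀ u v, σ u v = σ v u) {v₁ v₂ v₃ u₁ u₂ u₃ : V}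
    {f : V → Fin 12} (hf : ColorsOn G σ ({v₁, v₂, v₃}ᶜ) f)
    (h₁ : ∀ w, G.Adj v₁ w ↔ w = v₂ ∨ w = v₃ ∨ w = u₁)
    (h₂ : ∀ w, G.Adj v₂ w ↔ w = v₁ ∨ w = v₃ ∨ w = u₂)
    (h₃ : ∀ w, G.Adj v₃ w ↔ w = v₁ ∨ w = v₂ ∨ w = u₃)
    (hu₁ : u₁ ∉ ({v₁, v₂, v₃} : Finset V)) (hu₂ : u₂ ∉ ({v₁, v₂, v₃} : Finset V))
    (hu₃ : u₃ ∉ ({v₁, v₂, v₃} : Finset V))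
    (hne : signed (σ v₁ u₁) (f u₁) ≠ signed (σ v₂ u₂) (f u₂))
    (hne' : signed (σ v₁ u₁) (f u₁) ≠ antipode (signed (σ v₂ u₂) (f u₂))) :
    ∃ g, ColorsOn G σ Finset.univ g := by
  obtain ⟨x₁, x₂, x₃, hx₁, hx₂, hx₃, h₁₂, h₂₃, h₃₁⟩ := IcoAdj.exists_triangle
    (σ v₁ v₂) (σ v₂ v₃) (σ v₃ v₁) (signed (σ v₃ u₃) (f u₃)) hne hne'
  have n₁₂ : v₂ ≠ v₁ := ((h₁ v₂).mpr (by simp)).ne'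
  have n₁₃ : v₃ ≠ v₁ := ((h₁ v₃).mpr (by simp)).ne'
  have n₂₃ : v₃ ≠ v₂ := ((h₂ v₃).mpr (by simp)).ne'
  set g : V → Fin 12 := fun v =>
    if v = v₁ then x₁ else if v = v₂ then x₂ else if v = v₃ then x₃ else f v with hg
  have g₁ : g v₁ = x₁ := by simp [hg]
  have g₂ : g v₂ = x₂ := by simp [hg, n₁₂]
  have g₃ : g v₃ = x₃ := by simp [hg, n₁₃, n₂₃]
  have gD : ∀ v ∉ ({v₁, v₂, v₃} : Finset V), g v = f v := by
    intro v hv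
    simp only [Finset.mem_insert, Finset.mem_singleton, not_or] at hv
    simp [hg, hv]
  refine ⟨g, hf.extend hσ (fun v hv => gD v (Finset.mem_compl.mp hv)) fun v hv w hvw => ?_⟩
  rw [Finset.mem_compl, not_not, Finset.mem_insert, Finset.mem_insert, Finset.mem_singleton] at hv
  rcases hv with rfl | rfl | rfl
  · rcases (h₁ w).mp hvw with rfl | rfl | rfl
    · rwa [g₁, g₂]
    · rw [g₁, g₃, hσ]
      exact h₃₁.flip
    · rwa [g₁, gD _ hu₁]
  · rcases (h₂ w).mp hvw with rfl | rfl | rfl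
    · rw [g₁, g₂, hσ]
      exact h₁₂.flip
    · rwa [g₂, g₃]
    · rwa [g₂, gD _ hu₂]
  · rcases (h₃ w).mp hvw with rfl | rfl | rfl
    · rwa [g₁, g₃]
    · rw [g₂, g₃, hσ]
      exact h₂₃.flip
    · rwa [g₃, gD _ hu₃]

theorem ColorsOn.exists_of_square (hσ : ∀ u v, σ u v = σ v u) {v₁ v₂ v₃ v₄ u₁ u₂ u₃ u₄ : V}
    {f : V → Fin 12} (hf : ColorsOn G σ ({v₁, v₂, v₃, v₄}ᶜ) f)
    (h₁ : ∀ w, G.Adj v₁ w ↔ w = v₂ ∨ w = v₄ ∨ w = u₁)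
    (h₂ : ∀ w, G.Adj v₂ w ↔ w = v₁ ∨ w = v₃ ∨ w = u₂)
    (h₃ : ∀ w, G.Adj v₃ w ↔ w = v₂ ∨ w = v₄ ∨ w = u₃)
    (h₄ : ∀ w, G.Adj v₄ w ↔ w = v₁ ∨ w = v₃ ∨ w = u₄)
    (n₁₃ : v₃ ≠ v₁) (n₂₄ : v₄ ≠ v₂)
    (hu₁ : u₁ ∉ ({v₁, v₂, v₃, v₄} : Finset V)) (hu₂ : u₂ ∉ ({v₁, v₂, v₃, v₄} : Finset V))
    (hu₃ : u₃ ∉ ({v₁, v₂, v₃, v₄} : Finset V)) (hu₄ : u₄ ∉ ({v₁, v₂, v₃, v₄} : Finset V)) :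
    ∃ g, ColorsOn G σ Finset.univ g := by
  obtain ⟨x₁, x₂, x₃, x₄, hx₁, hx₂, hx₃, hx₄, h₁₂, h₂₃, h₃₄, h₄₁⟩ := IcoAdj.exists_square
    (σ v₁ v₂) (σ v₂ v₃) (σ v₃ v₄) (σ v₄ v₁) (signed (σ v₁ u₁) (f u₁)) (signed (σ v₂ u₂) (f u₂))
    (signed (σ v₃ u₃) (f u₃)) (signed (σ v₄ u₄) (f u₄))
  have n₁₂ : v₂ ≠ v₁ := ((h₁ v₂).mpr (by simp)).ne'
  have n₁₄ : v₄ ≠ v₁ := ((h₁ v₄).mpr (by simp)).ne'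
  have n₂₃ : v₃ ≠ v₂ := ((h₂ v₃).mpr (by simp)).ne'
  have n₃₄ : v₄ ≠ v₃ := ((h₃ v₄).mpr (by simp)).ne'
  set g : V → Fin 12 := fun v => if v = v₁ then x₁ else if v = v₂ then x₂ else
    if v = v₃ then x₃ else if v = v₄ then x₄ else f v with hg
  have g₁ : g v₁ = x₁ := by simp [hg]
  have g₂ : g v₂ = x₂ := by simp [hg, n₁₂]
  have g₃ : g v₃ = x₃ := by simp [hg, n₁₃, n₂₃]
  have g₄ : g v₄ = x₄ := by simp [hg, n₁₄, n₂₄, n₃₄]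
  have gD : ∀ v ∉ ({v₁, v₂, v₃, v₄} : Finset V), g v = f v := by
    intro v hv
    simp only [Finset.mem_insert, Finset.mem_singleton, not_or] at hv
    simp [hg, hv]
  refine ⟨g, hf.extend hσ (fun v hv => gD v (Finset.mem_compl.mp hv)) fun v hv w hvw => ?_⟩
  simp only [Finset.mem_compl, not_not, Finset.mem_insert, Finset.mem_singleton] at hv
  rcases hv with rfl | rfl | rfl | rfl
  · rcases (h₁ w).mp hvw with rfl | rfl | rfl
    · rwa [g₁, g₂]
    · rw [g₁, g₄, hσ]
      exact h₄₁.flip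
    · rwa [g₁, gD _ hu₁]
  · rcases (h₂ w).mp hvw with rfl | rfl | rfl
    · rw [g₁, g₂, hσ]
      exact h₁₂.flip
    · rwa [g₂, g₃]
    · rwa [g₂, gD _ hu₂]
  · rcases (h₃ w).mp hvw with rfl | rfl | rfl
    · rw [g₂, g₃, hσ]
      exact h₂₃.flip
    · rwa [g₃, g₄]
    · rwa [g₃, gD _ hu₃]
  · rcases (h₄ w).mp hvw with rfl | rfl | rfl
    · rwa [g₁, g₄]
    · rw [g₃, g₄, hσ]
      exact h₃₄.flip
    · rwa [g₄, gD _ hu₄]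

variable [DecidableRel G.Adj]

/-- By tameness no leaf sees antipodal colours outside, so each centre keeps at least four colours
that extend to its own leaves. Two such sets are always joined by an edge of the icosahedron. -/
theorem TameOn.exists_of_doubleStar (hσ : ∀ u v, σ u v = σ v u)
    (hdeg : ∀ v, (Finset.univ.filter (G.Adj v)).card ≤ 3) {r c a b d e : V}
    {f : V → Fin 12} (hf : TameOn G σ ({r, c, a, b, d, e}ᶜ) f)
    (hr : ∀ w, G.Adj r w ↔ w = c ∨ w = a ∨ w = b)
    (hc : ∀ w, G.Adj c w ↔ w = r ∨ w = d ∨ w = e)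
    (ha : ∀ w, G.Adj a w → w = r ∨ w ∉ ({r, c, a, b, d, e} : Finset V))
    (hb : ∀ w, G.Adj b w → w = r ∨ w ∉ ({r, c, a, b, d, e} : Finset V))
    (hd : ∀ w, G.Adj d w → w = c ∨ w ∉ ({r, c, a, b, d, e} : Finset V))
    (he : ∀ w, G.Adj e w → w = c ∨ w ∉ ({r, c, a, b, d, e} : Finset V))
    (hnd : [r, c, a, b, d, e].Nodup) :
    ∃ g, ColorsOn G σ Finset.univ g := by
  have pair : ∀ v ∈ ({r, c, a, b, d, e} : Finset V), ∀ u ∈ ({r, c, a, b, d, e} : Finset V),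
      G.Adj v u → ∃ p q, p ≠ antipode q ∧ ∀ x, IcoAdj x p → IcoAdj x q →
        ∀ w ∉ ({r, c, a, b, d, e} : Finset V), G.Adj v w → IcoAdj x (signed (σ v w) (f w)) := by
    intro v hv u hu hvu
    obtain ⟨p, q, hpq, h, -⟩ := hf.exists_pair (v := v) (fun h => Finset.mem_compl.mp h hv)
      (card_filter_adj_le (hdeg v) (u := u)
        (fun h => Finset.mem_compl.mp h hu) hvu)
    refine ⟨p, q, hpq, fun x hxp hxq w hw hvw => ?_⟩
    rcases h w (Finset.mem_compl.mpr hw) hvw with h | h <;> rwa [h]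
  obtain ⟨pa, qa, na, pa'⟩ := pair a (by simp) r (by simp) ((hr a).mpr (by simp)).symm
  obtain ⟨pb, qb, nb, pb'⟩ := pair b (by simp) r (by simp) ((hr b).mpr (by simp)).symm
  obtain ⟨pd, qd, nd, pd'⟩ := pair d (by simp) c (by simp) ((hc d).mpr (by simp)).symm
  obtain ⟨pe, qe, ne, pe'⟩ := pair e (by simp) c (by simp) ((hc e).mpr (by simp)).symm
  have hT := IcoAdj.four_le_card_cherry nd ne (σ c d) (σ c e)
  -- The colours for `c` are twisted by the sign of `rc`, so that plain adjacency expresses the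
  -- constraint on that edge.
  rw [← Finset.card_image_of_injective _ (signed_injective (σ r c))] at hT
  obtain ⟨xr, hxr, y, hy, hxy⟩ := IcoAdj.exists_of_four_le_card
    (IcoAdj.four_le_card_cherry na nb (σ r a) (σ r b)) hT
  obtain ⟨xc, hxc, rfl⟩ := Finset.mem_image.mp hy
  obtain ⟨⟨xa, hpa, hqa, hra⟩, xb, hpb, hqb, hrb⟩ := (Finset.mem_filter.mp hxr).2
  obtain ⟨⟨xd, hpd, hqd, hcd⟩, xe, hpe, hqe, hce⟩ := (Finset.mem_filter.mp hxc).2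
  simp only [List.nodup_cons, List.mem_cons, not_or, List.not_mem_nil, not_false_eq_true,
    List.nodup_nil, and_true] at hnd
  obtain ⟨⟨nrc, nra, nrb, nrd, nre⟩, ⟨nca, ncb, ncd, nce⟩, ⟨nab, nad, nae⟩, ⟨nbd, nbe⟩, nde⟩ := hnd
  set g : V → Fin 12 := fun v => if v = r then xr else if v = c then xc else if v = a then xa else
    if v = b then xb else if v = d then xd else if v = e then xe else f v with hg
  have gr : g r = xr := by simp [hg]
  have gc : g c = xc := by simp [hg, Ne.symm nrc]
  have ga : g a = xa := by simp [hg, Ne.symm nra, Ne.symm nca]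
  have gb : g b = xb := by simp [hg, Ne.symm nrb, Ne.symm ncb, Ne.symm nab]
  have gd : g d = xd := by simp [hg, Ne.symm nrd, Ne.symm ncd, Ne.symm nad, Ne.symm nbd]
  have ge : g e = xe := by
    simp [hg, Ne.symm nre, Ne.symm nce, Ne.symm nae, Ne.symm nbe, Ne.symm nde]
  have gD : ∀ v ∉ ({r, c, a, b, d, e} : Finset V), g v = f v := by
    intro v hv
    simp only [Finset.mem_insert, Finset.mem_singleton, not_or] at hv
    simp [hg, hv]
  refine ⟨g, hf.colorsOn.extend hσ (fun v hv => gD v (Finset.mem_compl.mp hv))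
    fun v hv w hvw => ?_⟩
  simp only [Finset.mem_compl, not_not] at hv
  rw [Finset.mem_insert, Finset.mem_insert, Finset.mem_insert, Finset.mem_insert,
    Finset.mem_insert, Finset.mem_singleton] at hv
  rcases hv with h | h | h | h | h | h
  · subst v
    rcases (hr w).mp hvw with h | h | h <;> subst w
    · rwa [gr, gc]
    · rwa [gr, ga]
    · rwa [gr, gb]
  · subst v
    rcases (hc w).mp hvw with h | h | h <;> subst w
    · rw [gr, gc, hσ]
      exact hxy.flip
    · rwa [gc, gd]
    · rwa [gc, ge]
  · subst v
    rcases ha w hvw with h | h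
    · subst w
      rw [ga, gr, hσ]
      exact hra.flip
    · rw [ga, gD w h]
      exact pa' xa hpa hqa w h hvw
  · subst v
    rcases hb w hvw with h | h
    · subst w
      rw [gb, gr, hσ]
      exact hrb.flip
    · rw [gb, gD w h]
      exact pb' xb hpb hqb w h hvw
  · subst v
    rcases hd w hvw with h | h
    · subst w
      rw [gd, gc, hσ]
      exact hcd.flip
    · rw [gd, gD w h]
      exact pd' xd hpd hqd w h hvw
  · subst v
    rcases he w hvw with h | h
    · subst w
      rw [ge, gc, hσ]
      exact hce.flip
    · rw [ge, gD w h]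
      exact pe' xe hpe hqe w h hvw

theorem exists_colorsOn_of_degree_le_two (hσ : ∀ u v, σ u v = σ v u) (hG : G.Connected)
    (hdeg : ∀ v, (Finset.univ.filter (G.Adj v)).card ≤ 3) {r : V}
    (hr : (Finset.univ.filter (G.Adj r)).card ≤ 2) :
    ∃ g, ColorsOn G σ Finset.univ g := by
  have hrD : r ∉ Finset.univ.erase r := Finset.notMem_erase _ _
  obtain ⟨f, hf⟩ := exists_tameOn hσ hG hdeg (Finset.univ.erase r)
    (fun h => by rw [h] at hrD; exact hrD (Finset.mem_univ r))
  obtain ⟨c, hc⟩ := hf.exists_insert hσ hdeg hrD ((Finset.card_le_card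
    (Finset.filter_subset_filter _ (Finset.subset_univ _))).trans hr)
  rw [Finset.insert_erase (Finset.mem_univ r)] at hc
  exact ⟨_, hc.colorsOn⟩

end Extension

/-! ### Cubic graphs, by girth. -/

section Cubic

variable {V : Type u} {G : SimpleGraph V} {σ : V → V → ℤˣ}

theorem eq_of_isClosed_neighbors [Fintype V] (hG : G.Connected) {C : Finset V} {v : V} (hv : v ∈ C)
    (h : ∀ x ∈ C, ∀ y, G.Adj x y → y ∈ C) : C = Finset.univ := by
  refine Finset.eq_univ_iff_forall.mpr fun w => ?_
  by_contra hw
  obtain ⟨p⟩ := hG.preconnected v w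
  obtain ⟨d, -, hd, hd'⟩ := p.exists_boundary_dart (C : Set V) hv hw
  exact hd' (h _ hd _ d.adj)

/-- The neighbours of a leaf of the double star around the edge `rc`, in a graph of girth at least
five. -/
theorem leaf_neighbors (htri : ∀ x y z, G.Adj x y → G.Adj y z → ¬ G.Adj x z)
    (hsq : ∀ v₁ v₂ v₃ v₄, G.Adj v₁ v₂ → G.Adj v₂ v₃ → G.Adj v₃ v₄ → G.Adj v₄ v₁ →
      v₁ = v₃ ∨ v₂ = v₄) {r c a b d e : V} (hrc : G.Adj r c) (hra : G.Adj r a) (hrb : G.Adj r b)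
    (hcd : G.Adj c d) (hce : G.Adj c e) (hac : a ≠ c) (hdr : d ≠ r) (her : e ≠ r) {w : V}
    (hw : G.Adj a w) : w = r ∨ w ≠ r ∧ w ≠ c ∧ w ≠ a ∧ w ≠ b ∧ w ≠ d ∧ w ≠ e := by
  refine or_iff_not_imp_left.mpr fun hwr => ⟨hwr, ?_, hw.ne', ?_, ?_, ?_⟩ <;> rintro rfl
  · exact htri _ _ _ hra hw hrc
  · exact htri _ _ _ hra hw hrb
  · exact (hsq _ _ _ _ hra hw hcd.symm hrc.symm).elim hdr.symm hac
  · exact (hsq _ _ _ _ hra hw hce.symm hrc.symm).elim her.symm hac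

variable [Fintype V] [DecidableEq V] [DecidableRel G.Adj]

theorem exists_third_neighbor {v x y : V} (hv : (Finset.univ.filter (G.Adj v)).card = 3)
    (hx : G.Adj v x) (hy : G.Adj v y) (hxy : x ≠ y) :
    ∃ z, z ≠ v ∧ z ≠ x ∧ z ≠ y ∧ ∀ w, G.Adj v w ↔ w = x ∨ w = y ∨ w = z := by
  have hx' : x ∈ Finset.univ.filter (G.Adj v) := by simpa using hx
  have hy' : y ∈ (Finset.univ.filter (G.Adj v)).erase x := by simpa using ⟨hxy.symm, hy⟩
  obtain ⟨z, hz⟩ := Finset.card_eq_one.mp (show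
    (((Finset.univ.filter (G.Adj v)).erase x).erase y).card = 1 by
      rw [Finset.card_erase_of_mem hy', Finset.card_erase_of_mem hx', hv])
  have hmem : ∀ w, (w ≠ y ∧ w ≠ x ∧ G.Adj v w) ↔ w = z := fun w => by
    simpa using Finset.ext_iff.mp hz w
  obtain ⟨hzy, hzx, hvz⟩ := (hmem z).mpr rfl
  refine ⟨z, hvz.ne', hzx, hzy, fun w => ⟨fun hw => ?_, ?_⟩⟩
  · have := hmem w
    tauto
  · rintro (rfl | rfl | rfl)
    exacts [hx, hy, hvz]

theorem exists_other_neighbors {v x : V} (hv : (Finset.univ.filter (G.Adj v)).card = 3)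
    (hx : G.Adj v x) :
    ∃ y z, y ≠ x ∧ z ≠ x ∧ y ≠ z ∧ ∀ w, G.Adj v w ↔ w = x ∨ w = y ∨ w = z := by
  obtain ⟨y, hy, hyx⟩ := Finset.exists_mem_ne (by omega : 1 < (Finset.univ.filter (G.Adj v)).card) x
  obtain ⟨z, -, hzx, hzy, h⟩ := exists_third_neighbor hv hx (Finset.mem_filter.mp hy).2 hyx.symm
  exact ⟨y, z, hyx, hzx, hzy.symm, h⟩

/-- Leaving `u₁` unlabelled as well gives freedom in its colour: one of its candidates makes the
colours seen by `v₁` and `v₂` differ up to sign, and then the triangle can be completed. -/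
theorem exists_colorsOn_of_triangle (hσ : ∀ u v, σ u v = σ v u) (hG : G.Connected)
    (hdeg : ∀ v, (Finset.univ.filter (G.Adj v)).card ≤ 3) {v₁ v₂ v₃ u₁ u₂ u₃ : V}
    (h₁ : ∀ w, G.Adj v₁ w ↔ w = v₂ ∨ w = v₃ ∨ w = u₁)
    (h₂ : ∀ w, G.Adj v₂ w ↔ w = v₁ ∨ w = v₃ ∨ w = u₂)
    (h₃ : ∀ w, G.Adj v₃ w ↔ w = v₁ ∨ w = v₂ ∨ w = u₃)
    (hu₁ : u₁ ∉ ({v₁, v₂, v₃} : Finset V)) (hu₂ : u₂ ∉ ({v₁, v₂, v₃} : Finset V))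
    (hu₃ : u₃ ∉ ({v₁, v₂, v₃} : Finset V)) (hu : u₁ ≠ u₂) :
    ∃ g, ColorsOn G σ Finset.univ g := by
  have hv₁ : v₁ ∉ (insert u₁ {v₁, v₂, v₃} : Finset V)ᶜ := by simp
  have hu₁' : u₁ ∉ (insert u₁ {v₁, v₂, v₃} : Finset V)ᶜ := by simp
  obtain ⟨f, hf⟩ := exists_tameOn hσ hG hdeg (insert u₁ {v₁, v₂, v₃} : Finset V)ᶜ
    (fun h => by rw [h] at hv₁; exact hv₁ (Finset.mem_univ _))
  obtain ⟨p, q, hpq, hseen, -⟩ := hf.exists_pair hu₁'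
    (card_filter_adj_le (hdeg u₁) hv₁ ((h₁ u₁).mpr (by simp)).symm)
  obtain ⟨c, hcp, hcq, hc, hc'⟩ := IcoAdj.exists_common_avoiding hpq
    (signed (σ v₁ u₁) (signed (σ v₂ u₂) (f u₂)))
  have hg := hf.colorsOn.insert hσ hu₁' (c := c) fun u hu h => by
    rcases hseen u hu h with h | h <;> rwa [h]
  rw [Finset.compl_insert, Finset.insert_erase (Finset.mem_compl.mpr hu₁)] at hg
  refine hg.exists_of_triangle hσ h₁ h₂ h₃ hu₁ hu₂ hu₃ ?_ ?_
  · rw [Function.update_self, Function.update_of_ne hu.symm]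
    rintro h
    exact hc (by rw [← h, signed_signed_self])
  · rw [Function.update_self, Function.update_of_ne hu.symm]
    rintro h
    exact hc' (by rw [← signed_antipode, ← h, signed_signed_self])

/-- A connected cubic signed graph with a triangle can be coloured unless it is `K₄`. -/
theorem exists_colorsOn_or_card_le_of_triangle (hσ : ∀ u v, σ u v = σ v u) (hG : G.Connected)
    (hcub : ∀ v, (Finset.univ.filter (G.Adj v)).card = 3) {v₁ v₂ v₃ : V} (h₁₂ : G.Adj v₁ v₂)
    (h₂₃ : G.Adj v₂ v₃) (h₁₃ : G.Adj v₁ v₃) :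
    (∃ g, ColorsOn G σ Finset.univ g) ∨ Fintype.card V ≤ 4 := by
  have hdeg : ∀ v, (Finset.univ.filter (G.Adj v)).card ≤ 3 := fun v => (hcub v).le
  obtain ⟨u₁, hu₁₁, hu₁₂, hu₁₃, h₁⟩ := exists_third_neighbor (hcub v₁) h₁₂ h₁₃ h₂₃.ne
  obtain ⟨u₂, hu₂₂, hu₂₁, hu₂₃, h₂⟩ := exists_third_neighbor (hcub v₂) h₁₂.symm h₂₃ h₁₃.ne
  obtain ⟨u₃, hu₃₃, hu₃₁, hu₃₂, h₃⟩ := exists_third_neighbor (hcub v₃) h₁₃.symm h₂₃.symm h₁₂.ne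
  by_cases hu : u₁ = u₂
  · by_cases hu' : u₁ = u₃
    · subst hu hu'
      right
      obtain ⟨z, -, -, -, h₄⟩ := exists_third_neighbor (hcub u₁) ((h₁ u₁).mpr (by simp)).symm
        ((h₂ u₁).mpr (by simp)).symm h₁₂.ne
      -- When all three outer neighbours coincide, the four vertices are closed under adjacency and
      -- exhaust the connected graph.
      obtain rfl : v₃ = z := by
        have := (h₄ v₃).mp ((h₃ u₁).mpr (by simp)).symm
        have := h₁₃.ne'
        have := h₂₃.ne'
        tauto
      have := eq_of_isClosed_neighbors hG (C := {v₁, v₂, v₃, u₁}) (v := v₁) (by simp) (by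
        intro x hx y hxy
        simp only [Finset.mem_insert, Finset.mem_singleton] at hx ⊢
        rcases hx with rfl | rfl | rfl | rfl
        · have := (h₁ y).mp hxy
          tauto
        · have := (h₂ y).mp hxy
          tauto
        · have := (h₃ y).mp hxy
          tauto
        · have := (h₄ y).mp hxy
          tauto)
      rw [← Finset.card_univ, ← this]
      exact Finset.card_le_four
    · refine Or.inl (exists_colorsOn_of_triangle hσ hG hdeg (v₁ := v₁) (v₂ := v₃) (v₃ := v₂)
        (fun w => (h₁ w).trans or_left_comm) h₃ h₂ ?_ ?_ ?_ hu')
      all_goals simp_all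
  · refine Or.inl (exists_colorsOn_of_triangle hσ hG hdeg h₁ h₂ h₃ ?_ ?_ ?_ hu)
    all_goals simp_all

theorem exists_colorsOn_of_square (hσ : ∀ u v, σ u v = σ v u) (hG : G.Connected)
    (hcub : ∀ v, (Finset.univ.filter (G.Adj v)).card = 3)
    (htri : ∀ x y z, G.Adj x y → G.Adj y z → ¬ G.Adj x z) {v₁ v₂ v₃ v₄ : V} (h₁₂ : G.Adj v₁ v₂)
    (h₂₃ : G.Adj v₂ v₃) (h₃₄ : G.Adj v₃ v₄) (h₄₁ : G.Adj v₄ v₁) (h₁₃ : v₁ ≠ v₃) (h₂₄ : v₂ ≠ v₄) :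
    ∃ g, ColorsOn G σ Finset.univ g := by
  have hv₁ : v₁ ∉ ({v₁, v₂, v₃, v₄} : Finset V)ᶜ := by simp
  obtain ⟨f, hf⟩ := exists_tameOn hσ hG (fun v => (hcub v).le) ({v₁, v₂, v₃, v₄} : Finset V)ᶜ
    (fun h => by rw [h] at hv₁; exact hv₁ (Finset.mem_univ _))
  have a₁₃ : ¬ G.Adj v₁ v₃ := htri _ _ _ h₁₂ h₂₃
  have a₂₄ : ¬ G.Adj v₂ v₄ := htri _ _ _ h₂₃ h₃₄
  obtain ⟨u₁, hu₁₁, hu₁₂, hu₁₄, h₁⟩ := exists_third_neighbor (hcub v₁) h₁₂ h₄₁.symm h₂₄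
  obtain ⟨u₂, hu₂₂, hu₂₁, hu₂₃, h₂⟩ := exists_third_neighbor (hcub v₂) h₁₂.symm h₂₃ h₁₃
  obtain ⟨u₃, hu₃₃, hu₃₂, hu₃₄, h₃⟩ := exists_third_neighbor (hcub v₃) h₂₃.symm h₃₄ h₂₄
  obtain ⟨u₄, hu₄₄, hu₄₁, hu₄₃, h₄⟩ := exists_third_neighbor (hcub v₄) h₄₁ h₃₄.symm h₁₃
  have hu₁₃ : u₁ ≠ v₃ := fun h => a₁₃ ((h₁ v₃).mpr (by simp [h]))
  have hu₂₄ : u₂ ≠ v₄ := fun h => a₂₄ ((h₂ v₄).mpr (by simp [h]))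
  have hu₃₁ : u₃ ≠ v₁ := fun h => a₁₃ ((h₃ v₁).mpr (by simp [h])).symm
  have hu₄₂ : u₄ ≠ v₂ := fun h => a₂₄ ((h₄ v₂).mpr (by simp [h])).symm
  refine hf.colorsOn.exists_of_square hσ h₁ h₂ h₃ h₄ h₁₃.symm h₂₄.symm ?_ ?_ ?_ ?_ <;>
    simp only [Finset.mem_insert, Finset.mem_singleton, not_or] <;> tauto

theorem exists_colorsOn_of_girth (hσ : ∀ u v, σ u v = σ v u) (hG : G.Connected)
    (hcub : ∀ v, (Finset.univ.filter (G.Adj v)).card = 3)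
    (htri : ∀ x y z, G.Adj x y → G.Adj y z → ¬ G.Adj x z)
    (hsq : ∀ v₁ v₂ v₃ v₄, G.Adj v₁ v₂ → G.Adj v₂ v₃ → G.Adj v₃ v₄ → G.Adj v₄ v₁ →
      v₁ = v₃ ∨ v₂ = v₄) :
    ∃ g, ColorsOn G σ Finset.univ g := by
  obtain ⟨r⟩ := hG.nonempty
  obtain ⟨c, hc⟩ := Finset.card_pos.mp (by rw [hcub r]; norm_num :
    0 < (Finset.univ.filter (G.Adj r)).card)
  have hrc : G.Adj r c := (Finset.mem_filter.mp hc).2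
  obtain ⟨a, b, hac, hbc, hab, hr⟩ := exists_other_neighbors (hcub r) hrc
  obtain ⟨d, e, hdr, her, hde, hc⟩ := exists_other_neighbors (hcub c) hrc.symm
  have hra : G.Adj r a := (hr a).mpr (by simp)
  have hrb : G.Adj r b := (hr b).mpr (by simp)
  have hcd : G.Adj c d := (hc d).mpr (by simp)
  have hce : G.Adj c e := (hc e).mpr (by simp)
  have hrD : r ∉ ({r, c, a, b, d, e} : Finset V)ᶜ := by simp
  obtain ⟨f, hf⟩ := exists_tameOn hσ hG (fun v => (hcub v).le) ({r, c, a, b, d, e} : Finset V)ᶜ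
    (fun h => by rw [h] at hrD; exact hrD (Finset.mem_univ _))
  refine hf.exists_of_doubleStar hσ (fun v => (hcub v).le) hr hc (fun w hw => ?_) (fun w hw => ?_)
    (fun w hw => ?_) (fun w hw => ?_) ?_
  · have := leaf_neighbors htri hsq hrc hra hrb hcd hce hac hdr her hw
    simp only [Finset.mem_insert, Finset.mem_singleton]
    tauto
  · have := leaf_neighbors htri hsq hrc hrb hra hcd hce hbc hdr her hw
    simp only [Finset.mem_insert, Finset.mem_singleton]
    tauto
  · have := leaf_neighbors htri hsq hrc.symm hcd hce hra hrb hdr hac hbc hw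
    simp only [Finset.mem_insert, Finset.mem_singleton]
    tauto
  · have := leaf_neighbors htri hsq hrc.symm hce hcd hra hrb her hac hbc hw
    simp only [Finset.mem_insert, Finset.mem_singleton]
    tauto
  · have n₁ : ∀ x, G.Adj r x → ¬ G.Adj c x := fun x h h' => htri _ _ _ hrc h' h
    have hne : ∀ x y, G.Adj r x → G.Adj c y → x ≠ y := fun x y h h' hxy => n₁ x h (hxy ▸ h')
    simp only [List.nodup_cons, List.mem_cons, not_or, List.not_mem_nil, not_false_eq_true,
      List.nodup_nil, and_true]
    exact ⟨⟨hrc.ne, hra.ne, hrb.ne, hdr.symm, her.symm⟩, ⟨hac.symm, hbc.symm, hcd.ne, hce.ne⟩,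
      ⟨hab, hne a d hra hcd, hne a e hra hce⟩, ⟨hne b d hrb hcd, hne b e hrb hce⟩, hde⟩

/-- Every connected subcubic signed graph with more than four vertices has a homomorphism to the
icosahedron graph with positive edges between adjacent and negative edges between second-nearest
vertices. -/
theorem exists_colorsOn_or_card_le (hσ : ∀ u v, σ u v = σ v u) (hG : G.Connected)
    (hdeg : ∀ v, (Finset.univ.filter (G.Adj v)).card ≤ 3) :
    (∃ g, ColorsOn G σ Finset.univ g) ∨ Fintype.card V ≤ 4 := by
  by_cases hcub : ∀ v, (Finset.univ.filter (G.Adj v)).card = 3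
  · by_cases htri : ∀ x y z, G.Adj x y → G.Adj y z → ¬ G.Adj x z
    · by_cases hsq : ∀ v₁ v₂ v₃ v₄, G.Adj v₁ v₂ → G.Adj v₂ v₃ → G.Adj v₃ v₄ → G.Adj v₄ v₁ →
          v₁ = v₃ ∨ v₂ = v₄
      · exact Or.inl (exists_colorsOn_of_girth hσ hG hcub htri hsq)
      · push Not at hsq
        obtain ⟨v₁, v₂, v₃, v₄, h₁₂, h₂₃, h₃₄, h₄₁, h₁₃, h₂₄⟩ := hsq
        exact Or.inl (exists_colorsOn_of_square hσ hG hcub htri h₁₂ h₂₃ h₃₄ h₄₁ h₁₃ h₂₄)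
    · push Not at htri
      obtain ⟨x, y, z, hxy, hyz, hxz⟩ := htri
      exact exists_colorsOn_or_card_le_of_triangle hσ hG hcub hxy hyz hxz
  · push Not at hcub
    obtain ⟨r, hr⟩ := hcub
    exact Or.inl (exists_colorsOn_of_degree_le_two hσ hG hdeg (r := r) (by have := hdeg r; omega))

end Cubic

/-! ### From labellings to homomorphisms. -/

namespace SignedGraph

variable {V : Type u} {W : Type v}

open Classical in
/-- The signature of a signed graph as a function of two vertices, with value `1` on non-edges. -/
noncomputable def edgeSign (S : SignedGraph V) (a b : V) : ℤˣ :=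
  if h : S.graph.Adj a b then S.sign ⟨s(a, b), h⟩ else 1

theorem edgeSign_of_adj (S : SignedGraph V) {a b : V} (h : S.graph.Adj a b) :
    S.edgeSign a b = S.sign ⟨s(a, b), h⟩ := dif_pos h

theorem edgeSign_comm (S : SignedGraph V) (a b : V) : S.edgeSign a b = S.edgeSign b a := by
  by_cases h : S.graph.Adj a b
  · rw [edgeSign_of_adj S h, edgeSign_of_adj S h.symm]
    exact congrArg S.sign (Subtype.ext Sym2.eq_swap)
  · rw [edgeSign, edgeSign, dif_neg h, dif_neg fun h' => h h'.symm]

theorem walkSign_nil (S : SignedGraph V) (a : V) :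
    S.walkSign (SimpleGraph.Walk.nil : S.graph.Walk a a) = 1 := rfl

theorem walkSign_cons (S : SignedGraph V) {a b c : V} (h : S.graph.Adj a c)
    (p : S.graph.Walk c b) :
    S.walkSign (SimpleGraph.Walk.cons h p) = S.edgeSign a c * S.walkSign p := by
  rw [edgeSign_of_adj S h]
  rfl

/-- A map that preserves the signs of edges after switching at the vertices of sign `τ v = -1` is
a homomorphism. -/
theorem isHom_of_switching {S : SignedGraph V} {T : SignedGraph W} (f : S.graph →g T.graph)
    (τ : V → ℤˣ)
    (h : ∀ a b, S.graph.Adj a b → T.edgeSign (f a) (f b) = τ a * S.edgeSign a b * τ b) :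
    S.IsHom T f := by
  -- On open walks the switching factors at inner vertices cancel in pairs, leaving those of the
  -- ends; these cancel when the walk closes.
  have key : ∀ (a b : V) (p : S.graph.Walk a b),
      T.walkSign (p.map f) = τ a * S.walkSign p * τ b := by
    intro a b p
    induction p with
    | nil => rw [SimpleGraph.Walk.map_nil, walkSign_nil, walkSign_nil, mul_one, Int.units_mul_self]
    | @cons a c b hac p ih =>
      rw [SimpleGraph.Walk.map_cons, walkSign_cons, walkSign_cons, ih, h a c hac]
      have : τ c * τ c = 1 := Int.units_mul_self _
      calc τ a * S.edgeSign a c * τ c * (τ c * S.walkSign p * τ b)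
          = τ a * S.edgeSign a c * (τ c * τ c) * S.walkSign p * τ b := by simp only [mul_assoc]
        _ = _ := by rw [this]; simp only [mul_assoc, one_mul]
  intro a p
  rw [key, mul_comm (τ a), mul_assoc, Int.units_mul_self, mul_one]

/-- A homomorphism does not identify opposite vertices of a negative 4-cycle. -/
theorem IsHom.ne_of_negative_square {S : SignedGraph V} {T : SignedGraph W}
    {f : S.graph →g T.graph} (hf : S.IsHom T f) {a x b y : V} (hax : S.graph.Adj a x)
    (hxb : S.graph.Adj x b) (hby : S.graph.Adj b y) (hya : S.graph.Adj y a)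
    (hneg : S.edgeSign a x * S.edgeSign x b * S.edgeSign b y * S.edgeSign y a = -1) :
    f a ≠ f b := by
  intro hab
  have h := hf a (.cons hax (.cons hxb (.cons hby (.cons hya .nil))))
  simp only [SimpleGraph.Walk.map_cons, SimpleGraph.Walk.map_nil, walkSign_cons, walkSign_nil,
    mul_one, ← mul_assoc, hneg] at h
  -- Once `a` and `b` are identified, the image walk uses each of its two edges back and forth, so
  -- it is positive.
  rw [← hab, T.edgeSign_comm (f x), Int.units_mul_self, one_mul, T.edgeSign_comm (f y),
    Int.units_mul_self] at h
  exact absurd h (by decide)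

end SignedGraph

/-- The six diagonals of the icosahedron. -/
def diagonal (x : Fin 12) : Fin 6 := ⟨x.val / 2, by omega⟩

/-- The position of a vertex on its diagonal. -/
def diagonalSign (x : Fin 12) : ℤˣ := if x.val % 2 = 0 then 1 else -1

/-- The signature of the complete graph on the diagonals of the icosahedron. -/
def diagonalEdgeSign (i j : Fin 6) : ℤˣ :=
  -- Between two distinct diagonals the even end of one is adjacent to exactly one end of the other;
  -- the sign tells which. The value at `i = j` plays no role, as the graph has no loops.
  if IcoAdj ⟨2 * i.val, by omega⟩ ⟨2 * j.val, by omega⟩ then 1 else -1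

theorem diagonalEdgeSign_comm (i j : Fin 6) : diagonalEdgeSign i j = diagonalEdgeSign j i := by
  revert i j; decide +kernel

theorem diagonal_signed (s : ℤˣ) (x : Fin 12) : diagonal (signed s x) = diagonal x := by
  rcases Int.units_eq_one_or s with rfl | rfl
  · rfl
  · revert x; decide +kernel

theorem diagonalSign_signed (s : ℤˣ) (x : Fin 12) :
    diagonalSign (signed s x) = s * diagonalSign x := by
  rcases Int.units_eq_one_or s with rfl | rfl
  · simp
  · revert x; decide +kernel

theorem IcoAdj.diagonal_ne {x y : Fin 12} (h : IcoAdj x y) : diagonal x ≠ diagonal y := by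
  revert x y; decide +kernel

theorem IcoAdj.diagonalEdgeSign_eq {x y : Fin 12} (h : IcoAdj x y) :
    diagonalEdgeSign (diagonal x) (diagonal y) = diagonalSign x * diagonalSign y := by
  revert x y; decide +kernel

/-- The complete signed graph on the diagonals of the icosahedron. -/
def diagonalGraph : SignedGraph (ULift.{u} (Fin 6)) where
  graph := ⊤
  sign e := Sym2.lift ⟨fun i j => diagonalEdgeSign i.down j.down,
    fun _ _ => diagonalEdgeSign_comm _ _⟩ e.1

theorem diagonalGraph_edgeSign {i j : ULift.{u} (Fin 6)} (h : i ≠ j) :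
    diagonalGraph.edgeSign i j = diagonalEdgeSign i.down j.down :=
  SignedGraph.edgeSign_of_adj _ (show (⊤ : SimpleGraph _).Adj i j from h)

theorem ColorsOn.maps_diagonalGraph {V : Type u} [Fintype V] {S : SignedGraph V} {g : V → Fin 12}
    (h : ColorsOn S.graph S.edgeSign Finset.univ g) : S.Maps diagonalGraph.{u} := by
  have hne : ∀ a b, S.graph.Adj a b → ULift.up.{u} (diagonal (g a)) ≠ ULift.up (diagonal (g b)) := by
    intro a b hab heq
    have := (h a (Finset.mem_univ a) b (Finset.mem_univ b) hab).diagonal_ne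
    rw [diagonal_signed] at this
    exact this (ULift.up_injective heq)
  refine ⟨⟨fun v => ULift.up (diagonal (g v)), fun {a b} hab => hne a b hab⟩,
    SignedGraph.isHom_of_switching _ (fun v => diagonalSign (g v)) fun a b hab => ?_⟩
  have := (h a (Finset.mem_univ a) b (Finset.mem_univ b) hab).diagonalEdgeSign_eq
  rw [diagonal_signed, diagonalSign_signed] at this
  rw [mul_assoc, ← this]
  exact diagonalGraph_edgeSign (hne a b hab)

theorem chromaticNumber_le_six {V : Type u} [Finite V] (S : SignedGraph V)
    (hS : ConnectedMaxDegreeLE 3 V S.graph) : S.chromaticNumber ≤ 6 := by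
  classical
  have := Fintype.ofFinite V
  have hdeg : ∀ v, (Finset.univ.filter (S.graph.Adj v)).card ≤ 3 := by
    intro v
    have h := hS.2 v
    rw [show S.graph.neighborSet v = ((Finset.univ.filter (S.graph.Adj v) : Finset V) : Set V) by
      ext w; simp, Set.encard_coe_eq_coe_finsetCard] at h
    exact_mod_cast h
  rcases exists_colorsOn_or_card_le (S.edgeSign_comm) hS.1 hdeg with ⟨g, hg⟩ | hcard
  · exact S.isLeast_chromaticNumber.2
      ⟨ULift (Fin 6), inferInstance, diagonalGraph, by simp, hg.maps_diagonalGraph⟩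
  · exact (S.isLeast_chromaticNumber.2 ⟨V, inferInstance, S, Nat.card_eq_fintype_card,
      S.maps_refl⟩).trans (by omega)

/-! ### The extremal example. -/

/-- The complete bipartite graph `K₃,₃` in which two disjoint edges are negative. The two sides
are the even and the odd numbers. -/
def signedK33 : SignedGraph (ULift.{u} (Fin 6)) where
  graph :=
    { Adj := fun a b => a.down.val % 2 ≠ b.down.val % 2
      symm := ⟨fun _ _ h => Ne.symm h⟩
      loopless := ⟨fun _ h => h rfl⟩ }
  sign e := Sym2.lift ⟨fun a b => if a.down.val / 2 = b.down.val / 2 ∧ a.down.val / 2 ≠ 0 then -1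
    else 1, fun _ _ => if_congr ⟨fun h => ⟨h.1.symm, h.1 ▸ h.2⟩, fun h => ⟨h.1.symm, h.1 ▸ h.2⟩⟩
      rfl rfl⟩ e.1

theorem signedK33_edgeSign {a b : ULift.{u} (Fin 6)} (h : a.down.val % 2 ≠ b.down.val % 2) :
    signedK33.edgeSign a b =
      if a.down.val / 2 = b.down.val / 2 ∧ a.down.val / 2 ≠ 0 then -1 else 1 :=
  SignedGraph.edgeSign_of_adj _ (show signedK33.graph.Adj a b from h)

theorem signedK33_connectedMaxDegreeLE :
    ConnectedMaxDegreeLE 3 (ULift.{u} (Fin 6)) signedK33.graph := by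
  refine ⟨⟨fun a b => ?_⟩, fun v => ?_⟩
  · obtain ⟨c, hac, hcb⟩ | hab : (∃ c : Fin 6, a.down.val % 2 ≠ c.val % 2 ∧
        c.val % 2 ≠ b.down.val % 2) ∨ a.down.val % 2 ≠ b.down.val % 2 := by
      generalize a.down = a
      generalize b.down = b
      revert a b
      decide
    · have h₁ : signedK33.graph.Adj a ⟨c⟩ := hac
      have h₂ : signedK33.graph.Adj ⟨c⟩ b := hcb
      exact h₁.reachable.trans h₂.reachable
    · have h : signedK33.graph.Adj a b := hab
      exact h.reachable
  · have h : signedK33.graph.neighborSet v = ULift.up.{u} ''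
        ((Finset.univ.filter fun w : Fin 6 => v.down.val % 2 ≠ w.val % 2 : Finset (Fin 6)) :
          Set (Fin 6)) := by
      ext w
      simp only [SimpleGraph.mem_neighborSet, Set.mem_image, Finset.mem_coe, Finset.mem_filter,
        Finset.mem_univ, true_and]
      exact ⟨fun h => ⟨w.down, h, rfl⟩, by rintro ⟨x, hx, rfl⟩; exact hx⟩
    rw [h, ULift.up_injective.encard_image, Set.encard_coe_eq_coe_finsetCard]
    have : ∀ a : Fin 6, (Finset.univ.filter fun w : Fin 6 => a.val % 2 ≠ w.val % 2).card ≤ 3 := by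
      decide
    exact_mod_cast this v.down

/-- Vertices on different sides are adjacent. For vertices on the same side, the sign vectors
towards the other side are neither equal nor opposite, so some 4-cycle through both is negative. -/
theorem injective_of_isHom_signedK33 {W : Type v} {T : SignedGraph W}
    {f : signedK33.{u}.graph →g T.graph} (hf : signedK33.IsHom T f) : Function.Injective f := by
  intro a b hab
  by_contra hne
  by_cases h : a.down.val % 2 = b.down.val % 2
  · have key : ∀ a b : Fin 6, a ≠ b → a.val % 2 = b.val % 2 → ∃ x y : Fin 6,
        a.val % 2 ≠ x.val % 2 ∧ x.val % 2 ≠ b.val % 2 ∧ b.val % 2 ≠ y.val % 2 ∧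
        y.val % 2 ≠ a.val % 2 ∧
        (if a.val / 2 = x.val / 2 ∧ a.val / 2 ≠ 0 then -1 else 1 : ℤˣ) *
        (if x.val / 2 = b.val / 2 ∧ x.val / 2 ≠ 0 then -1 else 1) *
        (if b.val / 2 = y.val / 2 ∧ b.val / 2 ≠ 0 then -1 else 1) *
        (if y.val / 2 = a.val / 2 ∧ y.val / 2 ≠ 0 then -1 else 1) = -1 := by
      decide +kernel
    obtain ⟨x, y, h₁, h₂, h₃, h₄, hneg⟩ := key a.down b.down (fun h => hne (ULift.ext _ _ h)) h
    refine hf.ne_of_negative_square (x := ⟨x⟩) (y := ⟨y⟩) h₁ h₂ h₃ h₄ ?_ hab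
    rwa [signedK33_edgeSign h₁, signedK33_edgeSign h₂, signedK33_edgeSign h₃,
      signedK33_edgeSign h₄]
  · have hadj : signedK33.graph.Adj a b := h
    exact (f.map_adj hadj).ne hab

theorem signedK33_chromaticNumber : signedK33.{u}.chromaticNumber = 6 := by
  refine le_antisymm (chromaticNumber_le_six _ signedK33_connectedMaxDegreeLE) ?_
  obtain ⟨W, _, T, hcard, f, hf⟩ := signedK33.{u}.isLeast_chromaticNumber.1
  rw [← hcard]
  simpa using Nat.card_le_card_of_injective f (injective_of_isHom_signedK33 hf)

theorem theorem1p12 :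
    SignedGraph.FamilyHasChromaticNumber.{u} (ConnectedMaxDegreeLE.{u} 3) 6 := by
  refine ⟨⟨ULift (Fin 6), inferInstance, signedK33, signedK33_connectedMaxDegreeLE,
    signedK33_chromaticNumber.symm⟩, ?_⟩
  rintro n ⟨V, _, S, hS, rfl⟩
  exact chromaticNumber_le_six S hS
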